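/- Let $m,n\ge 0$ be integers and let $|\psi\rangle$ be a unit vector (pure state) in $\bigotimes_{i=1}^m\mathcal H_{A_i}\otimes\bigotimes_{j=1}^n\mathcal H_{B_j}$, where every $\mathcal H_{A_i}$ and $\mathcal H_{B_j}$ is a finite-dimensional complex Hilbert space (a qudit). For a set $X$ of parties with complement $\overline X$, let $\rho_X=\operatorname{tr}_{\overline X}|\psi\rangle\langle\psi|$ be the reduced density operator. For real $q,s$ with $q\ge 1$ and $qs\ge 1$, the unified $(q,s)$-concurrence of $|\psi\rangle$ with respect to the bipartition $X|\overline X$ is $$C_{q,s}^{X|\overline X}(|\psi\rangle)=1-\bigl(\operatorname{tr}\rho_X^{\,q}\bigr)^s .$$ Write $\mathbf A=A_1\cdots A_m$ and $\mathbf B=B_1\cdots B_n$. Then for all real $q,s$ with $q\ge1$ and $qs\ge1$, $$C_{q,s}^{\mathbf A|\mathbf B}(|\psi\rangle)\;\le\;\sum_{i=1}^m C_{q,s}^{A_i|\overline{A}_i}(|\psi\rangle),$$ where $\overline{A}_i$ denotes all parties other than $A_i$. -/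

import Mathlib

noncomputable section

namespace UnifiedConcurrence

/-- The projector `|ψ⟩⟨ψ|` of a vector `ψ ∈ ℂ^α`. -/
def pureDensity {α : Type*} (ψ : EuclideanSpace ℂ α) : Matrix α α ℂ :=
  Matrix.of fun x y => ψ x * star (ψ y)

/-- The partial trace over the second tensor factor of `ℂ^α ⊗ ℂ^β = ℂ^(α × β)`. -/
def partialTraceRight {α β : Type*} [Fintype β]
    (M : Matrix (α × β) (α × β) ℂ) : Matrix α α ℂ :=
  Matrix.of fun x y => ∑ z : β, M (x, z) (y, z)

/-- The reduced density operator `ρ_A = tr_B |ψ⟩⟨ψ|` of a bipartite vector. -/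
def reducedDensity {α β : Type*} [Fintype β]
    (ψ : EuclideanSpace ℂ (α × β)) : Matrix α α ℂ :=
  partialTraceRight (pureDensity ψ)

/-- `tr ρ^q` for a positive semidefinite matrix `ρ`, the real power being taken by the
functional calculus (i.e. on the eigenvalues). -/
def tracePow {α : Type*} [Fintype α] [DecidableEq α] (q : ℝ) (ρ : Matrix α α ℂ) : ℝ :=
  (Matrix.trace (cfc (fun x : ℝ => x ^ q) ρ)).re

/-- The sign factor. It is only meaningful in the two displayed parameter ranges and is set
to `0` outside of them. -/
def signFactor (q s : ℝ) : ℝ :=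
  open Classical in
  if 1 ≤ q ∧ 1 ≤ q * s then 1
  else if (0 < q ∧ q < 1) ∧ (0 < q * s ∧ q * s < 1) then -1
  else 0

/-- The unified `(q,s)`-concurrence `ε_{q,s} (1 - (tr ρ_A^q)^s)` of a bipartite pure state. -/
def concurrence {α β : Type*} [Fintype α] [DecidableEq α] [Fintype β]
    (q s : ℝ) (ψ : EuclideanSpace ℂ (α × β)) : ℝ :=
  signFactor q s * (1 - tracePow q (reducedDensity ψ) ^ s)

/-- The Hilbert space `⨂ₖ ℂ^(d k)` of a family of qudits, in the computational basis:
a vector is given by its coefficients at the multi-indices `|s₁ s₂ ⋯⟩`. -/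
abbrev QuditSpace {ι : Type*} [Fintype ι] (d : ι → ℕ) : Type _ :=
  EuclideanSpace ℂ ((k : ι) → Fin (d k))

/-- A multipartite vector, regarded as a bipartite vector with respect to the bipartition of
the parties into `S` and its complement. -/
def regroup {ι : Type*} [Fintype ι] [DecidableEq ι] {d : ι → ℕ} (S : Finset ι)
    (ψ : QuditSpace d) :
    EuclideanSpace ℂ (((k : {k // k ∈ S}) → Fin (d k)) × ((k : {k // k ∉ S}) → Fin (d k))) :=
  WithLp.toLp 2 fun x =>
    ψ ((Equiv.piEquivPiSubtypeProd (fun k => k ∈ S) (fun k => Fin (d k))).symm x)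

/-- The unified `(q,s)`-concurrence of a multipartite pure state across the bipartition
`S | Sᶜ` of the parties. -/
def bipartitionConcurrence {ι : Type*} [Fintype ι] [DecidableEq ι] {d : ι → ℕ}
    (q s : ℝ) (S : Finset ι) (ψ : QuditSpace d) : ℝ :=
  concurrence q s (regroup S ψ)

end UnifiedConcurrence

end

/-! ### Classical inequalities for probability vectors -/

namespace UnifiedConcurrence

open scoped NNReal

/-! Measure `ψ` in a product basis whose factors are eigenbases of the one-party reduced states.
Each one-party outcome distribution is then the spectrum of that party's state, while the joint
distribution on `S` is only the diagonal of `ρ_S`, so Peierls (`sum_diag_rpow_le_tracePow`) bounds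
its `q`-power sum by `tr ρ_S^q`. What remains is classical.

For `q > 1`, let `g i` be Hölder-dual to the `i`-th marginal. The product of the `g i` has `ℓ^p`
norm at most one, so its mean is at most the joint `q`-norm; averaging `1 - ∏ g i ≤ ∑ (1 - g i)`
gives subadditivity of `1 - ‖·‖_q`. Raising norms to the power `q * s ≥ 1` preserves it
(`one_sub_rpow_le_sum`) and yields `1 - (tr ρ^q)^s`. -/

/-- For numbers `g i ∈ [0, 1]`, one has `∑ (1 - g i) ≥ 1 - ∏ g i`. -/
lemma one_le_sum_one_sub_add_prod {ι : Type*} (s : Finset ι) (g : ι → ℝ)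
    (h0 : ∀ i, 0 ≤ g i) (h1 : ∀ i, g i ≤ 1) :
    1 ≤ ∑ i ∈ s, (1 - g i) + ∏ i ∈ s, g i := by
  classical
  induction s using Finset.induction_on with
  | empty => simp
  | insert a s ha ih =>
    rw [Finset.sum_insert ha, Finset.prod_insert ha]
    have hp : ∏ i ∈ s, g i ≤ 1 := Finset.prod_le_one (fun i _ => h0 i) (fun i _ => h1 i)
    nlinarith [mul_nonneg (sub_nonneg.2 (h1 a)) (sub_nonneg.2 hp)]

/-- Powers with exponent at least one preserve the inequality `1 - z ≤ ∑ (1 - x i)`. -/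
lemma one_sub_rpow_le_sum {ι : Type*} (s : Finset ι) (x : ι → ℝ) (z P : ℝ) (hP : 1 ≤ P)
    (hz : 0 ≤ z) (h0 : ∀ i, 0 ≤ x i) (h1 : ∀ i, x i ≤ 1)
    (h : 1 - z ≤ ∑ i ∈ s, (1 - x i)) :
    1 - z ^ P ≤ ∑ i ∈ s, (1 - x i ^ P) := by
  have hnn : ∀ i, 0 ≤ 1 - x i ^ P := fun i =>
    sub_nonneg.2 (Real.rpow_le_one (h0 i) (h1 i) (by linarith))
  rcases le_or_gt 1 z with hz1 | hz1
  · have := Real.one_le_rpow hz1 (by linarith : (0 : ℝ) ≤ P)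
    linarith [Finset.sum_nonneg fun i (_ : i ∈ s) => hnn i]
  -- If some `x i ≤ z`, its term alone suffices. Otherwise every `x i` lies in `(z, 1]`, and
  -- convexity puts `x i ^ P` below the chord from `z` to `1`.
  by_cases hex : ∃ i ∈ s, x i ≤ z
  · obtain ⟨i, hi, hiz⟩ := hex
    calc 1 - z ^ P ≤ 1 - x i ^ P :=
          sub_le_sub_left (Real.rpow_le_rpow (h0 i) hiz (by linarith)) _
      _ ≤ _ := Finset.single_le_sum (f := fun i => 1 - x i ^ P) (fun i _ => hnn i) hi
  push Not at hex
  have hw : 0 < 1 - z := by linarith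
  have hz' : 0 ≤ 1 - z ^ P := sub_nonneg.2 (Real.rpow_le_one hz hz1.le (by linarith))
  have hconv := convexOn_rpow hP
  have key : ∀ i ∈ s, (1 - x i) / (1 - z) * (1 - z ^ P) ≤ 1 - x i ^ P := by
    intro i hi
    have ht0 : 0 ≤ (1 - x i) / (1 - z) := div_nonneg (sub_nonneg.2 (h1 i)) hw.le
    have ht1 : (1 - x i) / (1 - z) ≤ 1 := by
      rw [div_le_one hw]; linarith [hex i hi]
    have hc := hconv.2 (Set.mem_Ici.2 hz) (Set.mem_Ici.2 zero_le_one) ht0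
      (sub_nonneg.2 ht1) (by ring)
    simp only [smul_eq_mul, Real.one_rpow, mul_one] at hc
    have hx : (1 - x i) / (1 - z) * z + (1 - (1 - x i) / (1 - z)) = x i := by
      field_simp
      ring
    rw [hx] at hc
    linarith
  calc 1 - z ^ P = (1 - z) / (1 - z) * (1 - z ^ P) := by rw [div_self hw.ne', one_mul]
    _ ≤ (∑ i ∈ s, (1 - x i)) / (1 - z) * (1 - z ^ P) := by gcongr
    _ = ∑ i ∈ s, (1 - x i) / (1 - z) * (1 - z ^ P) := by
      rw [Finset.sum_div, Finset.sum_mul]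
    _ ≤ _ := Finset.sum_le_sum key

/-- Subadditivity of `1 - ‖·‖_q` for probability vectors: the deficit of a joint distribution is
at most the sum of the deficits of its marginals. -/
lemma one_sub_norm_le_sum_marginals {ι β : Type*} [Fintype ι] [Fintype β]
    {α : ι → Type*} [∀ i, Fintype (α i)] [∀ i, DecidableEq (α i)]
    (f : ∀ i, β → α i) (hf : ∀ y y', (∀ i, f i y = f i y') → y = y')
    (r : β → ℝ≥0) (hr : ∑ y, r y = 1) (q : ℝ) (hq : 1 < q) :
    1 - ((∑ y, r y ^ q) ^ (1 / q) : ℝ≥0) ≤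
      ∑ i, (1 - (((∑ c, (∑ y, if f i y = c then r y else 0) ^ q) ^ (1 / q) : ℝ≥0) : ℝ)) := by
  classical
  have hpq : q.HolderConjugate q.conjExponent := Real.HolderConjugate.conjExponent hq
  set p := q.conjExponent
  have hdual : ∀ i, ∃ g : α i → ℝ≥0, ∑ c, g c ^ p ≤ 1 ∧
      ∑ y, r y * g (f i y) =
        (∑ c, (∑ y, if f i y = c then r y else 0) ^ q) ^ (1 / q) := by
    intro i
    obtain ⟨g, hg, hgs⟩ := (NNReal.isGreatest_Lp Finset.univ
      (fun c : α i => ∑ y, if f i y = c then r y else 0) hpq).1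
    refine ⟨g, hg, ?_⟩
    rw [← hgs]
    simp only [Finset.sum_mul]
    rw [Finset.sum_comm]
    simp
  choose g hg hgs using hdual
  have hg1 : ∀ i c, g i c ≤ 1 := by
    intro i c
    have h1 : g i c ^ p ≤ 1 :=
      (Finset.single_le_sum (f := fun c => g i c ^ p) (fun _ _ => zero_le) (Finset.mem_univ c)).trans
        (hg i)
    by_contra hc
    exact absurd (NNReal.one_lt_rpow (not_le.1 hc) hpq.symm.pos) (not_lt.2 h1)
  -- By `hf` the points `y` embed in the product of the `α i`, where the sum factorises.
  have hprod : ∑ y, (∏ i, g i (f i y)) ^ p ≤ 1 := by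
    calc ∑ y, (∏ i, g i (f i y)) ^ p = ∑ y, ∏ i, g i (f i y) ^ p := by
          simp only [NNReal.finsetProd_rpow]
      _ = ∑ a ∈ Finset.univ.image (fun y i => f i y), ∏ i, g i (a i) ^ p := by
          rw [Finset.sum_image]
          intro y _ y' _ h
          exact hf y y' (fun i => congrFun h i)
      _ ≤ ∑ a : ∀ i, α i, ∏ i, g i (a i) ^ p :=
          Finset.sum_le_sum_of_subset (Finset.subset_univ _)
      _ = ∏ i, ∑ c, g i c ^ p := by
          rw [Finset.prod_univ_sum, Fintype.piFinset_univ]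
      _ ≤ 1 := Finset.prod_le_one' fun i _ => hg i
  have hholder : ∑ y, r y * ∏ i, g i (f i y) ≤ (∑ y, r y ^ q) ^ (1 / q) :=
    (NNReal.isGreatest_Lp Finset.univ r hpq).2 ⟨_, hprod, rfl⟩
  have hholder' : ∑ y, (r y : ℝ) * ∏ i, (g i (f i y) : ℝ) ≤
      (((∑ y, r y ^ q) ^ (1 / q) : ℝ≥0) : ℝ) := by exact_mod_cast hholder
  have hr' : ∑ y, (r y : ℝ) = 1 := by exact_mod_cast hr
  have hsum : ∑ i, (1 - (((∑ c, (∑ y, if f i y = c then r y else 0) ^ q) ^ (1 / q) : ℝ≥0) : ℝ)) =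
      ∑ y, (r y : ℝ) * ∑ i, (1 - (g i (f i y) : ℝ)) := by
    simp only [Finset.mul_sum]
    rw [Finset.sum_comm]
    refine Finset.sum_congr rfl fun i _ => ?_
    rw [← hgs i]
    push_cast
    simp only [mul_sub, mul_one, Finset.sum_sub_distrib, hr']
  rw [hsum]
  have hpt : ∀ y, (r y : ℝ) * 1 ≤
      r y * (∑ i, (1 - (g i (f i y) : ℝ)) + ∏ i, (g i (f i y) : ℝ)) := fun y =>
    mul_le_mul_of_nonneg_left (one_le_sum_one_sub_add_prod _ _ (fun _ => NNReal.coe_nonneg _)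
      fun i => by exact_mod_cast hg1 i _) (NNReal.coe_nonneg _)
  have := Finset.sum_le_sum fun y (_ : y ∈ Finset.univ) => hpt y
  simp only [mul_add, mul_one, Finset.sum_add_distrib, hr'] at this
  linarith

end UnifiedConcurrence

/-! ### Spectra, diagonals and tensor products of unitaries -/

namespace UnifiedConcurrence

open Matrix
open scoped ComplexOrder

lemma tracePow_eq_sum_eigenvalues {α : Type*} [Fintype α] [DecidableEq α] (q : ℝ)
    {ρ : Matrix α α ℂ} (hρ : ρ.IsHermitian) :
    tracePow q ρ = ∑ i, hρ.eigenvalues i ^ q := by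
  rw [tracePow, hρ.cfc_eq, IsHermitian.cfc, Unitary.conjStarAlgAut_apply, trace_mul_comm,
    ← mul_assoc]
  simp [trace_diagonal]

lemma reducedDensity_eq_mul_conjTranspose {α β : Type*} [Fintype β]
    (φ : EuclideanSpace ℂ (α × β)) :
    reducedDensity φ = (of fun x z => φ (x, z)) * (of fun x z => φ (x, z))ᴴ := by
  ext x y
  simp [reducedDensity, partialTraceRight, pureDensity, mul_apply]

lemma posSemidef_reducedDensity {α β : Type*} [Finite α] [Fintype β] (φ : EuclideanSpace ℂ (α × β)) :
    (reducedDensity φ).PosSemidef := by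
  rw [reducedDensity_eq_mul_conjTranspose]
  exact posSemidef_self_mul_conjTranspose _

lemma exists_unitary_diagonal {α : Type*} [Fintype α] [DecidableEq α]
    {ρ : Matrix α α ℂ} (hρ : ρ.IsHermitian) :
    ∃ U ∈ unitaryGroup α ℂ, Uᴴ * ρ * U = diagonal fun i => (hρ.eigenvalues i : ℂ) := by
  refine ⟨hρ.eigenvectorUnitary, hρ.eigenvectorUnitary.2, ?_⟩
  have := hρ.conjStarAlgAut_star_eigenvectorUnitary
  rw [Unitary.conjStarAlgAut_apply] at this
  simpa [star_eq_conjTranspose, Function.comp_def] using this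

/-- Peierls' inequality for powers `q ≥ 1`: passing to the diagonal entries in an orthonormal basis
does not increase `tr ρ^q`. -/
lemma sum_diag_rpow_le_tracePow {α : Type*} [Fintype α] [DecidableEq α] (q : ℝ) (hq : 1 ≤ q)
    {ρ : Matrix α α ℂ} (hρ : ρ.PosSemidef) {W : Matrix α α ℂ} (hW : W ∈ unitaryGroup α ℂ) :
    ∑ x, ((W * ρ * Wᴴ) x x).re ^ q ≤ tracePow q ρ := by
  obtain ⟨U, hU, hd⟩ := exists_unitary_diagonal hρ.isHermitian
  rw [tracePow_eq_sum_eigenvalues q hρ.isHermitian]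
  set l := hρ.isHermitian.eigenvalues
  have hQ : W * U ∈ unitaryGroup α ℂ := mul_mem hW hU
  set Q := W * U
  have hUU : U * Uᴴ = 1 := mem_unitaryGroup_iff.1 hU
  have hdec : W * ρ * Wᴴ = Q * diagonal (fun i => (l i : ℂ)) * Qᴴ := by
    rw [← hd, conjTranspose_mul]
    calc W * ρ * Wᴴ = W * (U * Uᴴ) * ρ * (U * Uᴴ) * Wᴴ := by rw [hUU]; simp
      _ = _ := by simp only [Q, mul_assoc]
  -- The matrix of `|Q x k|²` is doubly stochastic: row sums permit Jensen, column sums recover `∑ l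
  -- k ^ q`.
  have hrow : ∀ x, ∑ k, Complex.normSq (Q x k) = 1 := by
    intro x
    have := congrFun (congrFun (mem_unitaryGroup_iff.1 hQ) x) x
    simp only [star_eq_conjTranspose, mul_apply, conjTranspose_apply, RCLike.star_def, Complex.mul_conj, one_apply_eq] at this
    exact_mod_cast this
  have hcol : ∀ k, ∑ x, Complex.normSq (Q x k) = 1 := by
    intro k
    have := congrFun (congrFun (mem_unitaryGroup_iff'.1 hQ) k) k
    simp only [star_eq_conjTranspose, mul_apply, conjTranspose_apply, RCLike.star_def,
      ← Complex.normSq_eq_conj_mul_self, one_apply_eq] at this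
    exact_mod_cast this
  have hdiag : ∀ x, ((W * ρ * Wᴴ) x x).re = ∑ k, Complex.normSq (Q x k) * l k := by
    intro x
    have : (W * ρ * Wᴴ) x x = ((∑ k, Complex.normSq (Q x k) * l k : ℝ) : ℂ) := by
      rw [hdec, mul_apply]
      push_cast
      refine Finset.sum_congr rfl fun k _ => ?_
      rw [mul_diagonal, conjTranspose_apply, RCLike.star_def, ← Complex.mul_conj]
      ring
    rw [this, Complex.ofReal_re]
  calc ∑ x, ((W * ρ * Wᴴ) x x).re ^ q
      ≤ ∑ x, ∑ k, Complex.normSq (Q x k) * l k ^ q := by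
        refine Finset.sum_le_sum fun x _ => ?_
        rw [hdiag]
        exact (convexOn_rpow hq).map_sum_le (fun k _ => Complex.normSq_nonneg _) (hrow x)
          (fun k _ => hρ.eigenvalues_nonneg k)
    _ = ∑ k, l k ^ q := by
        rw [Finset.sum_comm]
        simp only [← Finset.sum_mul, hcol, one_mul]

/-- The tensor product of a family of square matrices. -/
def tensorPi {κ : Type*} [Fintype κ] {a : κ → Type*} (V : ∀ k, Matrix (a k) (a k) ℂ) :
    Matrix (∀ k, a k) (∀ k, a k) ℂ :=
  of fun x y => ∏ k, V k (x k) (y k)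

lemma tensorPi_mem_unitaryGroup {κ : Type*} [Fintype κ] [DecidableEq κ] {a : κ → Type*}
    [∀ k, Fintype (a k)] [∀ k, DecidableEq (a k)] {V : ∀ k, Matrix (a k) (a k) ℂ}
    (hV : ∀ k, V k ∈ unitaryGroup (a k) ℂ) :
    tensorPi V ∈ unitaryGroup (∀ k, a k) ℂ := by
  rw [mem_unitaryGroup_iff]
  ext x y
  have h : ∀ k, ∑ c, V k (x k) c * star (V k (y k) c) = if x k = y k then 1 else 0 := by
    intro k
    have := congrFun (congrFun (mem_unitaryGroup_iff.1 (hV k)) (x k)) (y k)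
    simpa [mul_apply, star_eq_conjTranspose, one_apply] using this
  simp only [mul_apply, star_eq_conjTranspose, conjTranspose_apply, tensorPi, of_apply, star_prod,
    ← Finset.prod_mul_distrib]
  rw [← Fintype.piFinset_univ, ← Finset.prod_univ_sum (fun _ => Finset.univ)
    (fun k c => V k (x k) c * star (V k (y k) c))]
  simp only [h, one_apply, funext_iff]
  rw [Finset.prod_ite_zero]
  simp

/-! ### Local unitaries acting on multipartite states -/

section Qudits

variable {ι : Type*} [Fintype ι] [DecidableEq ι] {d : ι → ℕ}

/-- The action of a product of local operators on a multipartite vector. -/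
def applyLocal (V : ∀ k, Matrix (Fin (d k)) (Fin (d k)) ℂ) (ψ : QuditSpace d) : QuditSpace d :=
  WithLp.toLp 2 (tensorPi V *ᵥ ψ.ofLp)

/-- Across the cut, the coefficient matrix `M` of `ψ` becomes `D * M * Cᵀ`; the unitary `Cᵀ` on the
complement cancels in `M * Mᴴ`. -/
lemma reducedDensity_applyLocal (V : ∀ k, Matrix (Fin (d k)) (Fin (d k)) ℂ)
    (hV : ∀ k, V k ∈ unitaryGroup (Fin (d k)) ℂ) (ψ : QuditSpace d) (S : Finset ι) :
    reducedDensity (regroup S (applyLocal V ψ)) =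
      tensorPi (fun k : {k // k ∈ S} => V k) * reducedDensity (regroup S ψ) *
        (tensorPi fun k : {k // k ∈ S} => V k)ᴴ := by
  have hC : tensorPi (fun k : {k // k ∉ S} => V k) ∈ unitaryGroup _ ℂ :=
    tensorPi_mem_unitaryGroup fun k => hV k
  have hC' := congrArg transpose (mem_unitaryGroup_iff'.1 hC)
  set C := tensorPi (fun k : {k // k ∉ S} => V k) with hCdef
  set D := tensorPi (fun k : {k // k ∈ S} => V k) with hDdef
  have hCC : Cᵀ * Cᵀᴴ = 1 := by
    rw [transpose_mul, transpose_one] at hC'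
    exact hC'
  have hM : (of fun x z => regroup S (applyLocal V ψ) (x, z)) =
      D * (of fun x z => regroup S ψ (x, z)) * Cᵀ := by
    ext x z
    simp only [of_apply, mul_apply, transpose_apply, Finset.sum_mul]
    rw [Finset.sum_comm, ← Fintype.sum_prod_type']
    simp only [regroup, applyLocal, mulVec, dotProduct]
    refine Fintype.sum_equiv (Equiv.piEquivPiSubtypeProd (fun k => k ∈ S) fun k => Fin (d k))
      _ _ fun b => ?_
    rw [Prod.mk.eta, Equiv.symm_apply_apply]
    simp only [hCdef, hDdef, tensorPi, of_apply]
    rw [← Fintype.prod_subtype_mul_prod_subtype (fun k => k ∈ S), mul_right_comm]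
    congr 1
    congr 1
    · exact Finset.prod_congr (by ext; simp) fun k _ => by simp [Equiv.piEquivPiSubtypeProd, k.2]
    · exact Finset.prod_congr (by ext; simp) fun k _ => by simp [Equiv.piEquivPiSubtypeProd, k.2]
  rw [reducedDensity_eq_mul_conjTranspose, reducedDensity_eq_mul_conjTranspose, hM,
    conjTranspose_mul, conjTranspose_mul]
  set M : Matrix _ _ ℂ := of fun x z => regroup S ψ (x, z)
  calc D * M * Cᵀ * (Cᵀᴴ * (Mᴴ * Dᴴ)) = D * M * (Cᵀ * Cᵀᴴ) * (Mᴴ * Dᴴ) := by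
        simp only [Matrix.mul_assoc]
    _ = _ := by rw [hCC]; simp only [Matrix.mul_assoc, Matrix.one_mul]

/-- The diagonal of a reduced density operator is a marginal distribution. -/
lemma reducedDensity_diag (ψ : QuditSpace d) (S : Finset ι) (x : (k : {k // k ∈ S}) → Fin (d k)) :
    (reducedDensity (regroup S ψ) x x).re =
      ∑ a : (k : ι) → Fin (d k),
        if (fun k : {k // k ∈ S} => a k) = x then Complex.normSq (ψ a) else 0 := by
  rw [← (Equiv.piEquivPiSubtypeProd (fun k => k ∈ S) fun k => Fin (d k)).symm.sum_comp,
    Fintype.sum_prod_type, Finset.sum_eq_single x]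
  · simp [reducedDensity, partialTraceRight, pureDensity, regroup, Complex.mul_conj,
      Equiv.piEquivPiSubtypeProd]
  · intro y _ hy
    refine Finset.sum_eq_zero fun z _ => if_neg ?_
    intro h
    apply hy
    rw [← h]
    ext k
    simp [Equiv.piEquivPiSubtypeProd]
  · simp

lemma sum_normSq_applyLocal (V : ∀ k, Matrix (Fin (d k)) (Fin (d k)) ℂ)
    (hV : ∀ k, V k ∈ unitaryGroup (Fin (d k)) ℂ) (ψ : QuditSpace d) :
    ∑ a, Complex.normSq (applyLocal V ψ a) = ‖ψ‖ ^ 2 := by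
  have h : ∀ φ : QuditSpace d,
      (((∑ a, Complex.normSq (φ a) : ℝ)) : ℂ) = star φ.ofLp ⬝ᵥ φ.ofLp := by
    intro φ
    simp [dotProduct, Complex.normSq_eq_conj_mul_self]
  have hu : (tensorPi V)ᴴ * tensorPi V = 1 :=
    mem_unitaryGroup_iff'.1 (tensorPi_mem_unitaryGroup hV)
  have h2 : ∑ a, Complex.normSq (applyLocal V ψ a) = ∑ a, Complex.normSq (ψ a) := by
    apply Complex.ofReal_injective
    rw [h, h]
    change star (tensorPi V *ᵥ ψ.ofLp) ⬝ᵥ (tensorPi V *ᵥ ψ.ofLp) = _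
    rw [star_mulVec, dotProduct_mulVec, vecMul_vecMul, hu, vecMul_one]
  rw [h2, EuclideanSpace.norm_sq_eq]
  simp [Complex.normSq_eq_norm_sq]

/-- A local unitary diagonalising the reduced density operator of the party `k`. -/
lemma exists_local_diagonalisation (ψ : QuditSpace d) (q : ℝ) (k : ι) :
    ∃ V ∈ unitaryGroup (Fin (d k)) ℂ, ∀ W : ∀ j, Matrix (Fin (d j)) (Fin (d j)) ℂ, W k = V →
      ∑ x, ((tensorPi (fun j : {j // j ∈ ({k} : Finset ι)} => W j) *
        reducedDensity (regroup {k} ψ) *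
        (tensorPi fun j : {j // j ∈ ({k} : Finset ι)} => W j)ᴴ) x x).re ^ q =
      tracePow q (reducedDensity (regroup {k} ψ)) := by
  have hρ := (posSemidef_reducedDensity (regroup {k} ψ)).isHermitian
  obtain ⟨U, hU, hd⟩ := exists_unitary_diagonal hρ
  let e : ((j : {j // j ∈ ({k} : Finset ι)}) → Fin (d j)) ≃ Fin (d k) :=
    { toFun := fun x => x ⟨k, Finset.mem_singleton_self k⟩
      invFun := fun c j => Fin.cast (congrArg d (Finset.mem_singleton.1 j.2).symm) c
      left_inv := by
        intro x
        ext ⟨j, hj⟩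
        obtain rfl := Finset.mem_singleton.1 hj
        rfl
      right_inv := fun c => rfl }
  refine ⟨Uᴴ.submatrix e.symm e.symm, ?_, ?_⟩
  · rw [mem_unitaryGroup_iff, star_eq_conjTranspose, conjTranspose_submatrix,
      submatrix_mul_equiv, conjTranspose_conjTranspose]
    rw [← star_eq_conjTranspose, mem_unitaryGroup_iff'.1 hU, submatrix_one_equiv]
  -- A tensor product over the singleton sees only `W k`, so the other parties' unitaries may be
  -- chosen independently.
  · intro W hW
    have hT : tensorPi (fun j : {j // j ∈ ({k} : Finset ι)} => W j) = Uᴴ := by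
      ext x y
      have hp : ∀ j : {j // j ∈ ({k} : Finset ι)}, j = ⟨k, Finset.mem_singleton_self k⟩ :=
        fun j => Subtype.ext (Finset.mem_singleton.1 j.2)
      rw [tensorPi, of_apply, Fintype.prod_eq_single ⟨k, Finset.mem_singleton_self k⟩
        (fun j hj => absurd (hp j) hj)]
      change W k (e x) (e y) = _
      rw [hW, submatrix_apply, e.symm_apply_apply, e.symm_apply_apply]
    rw [hT, conjTranspose_conjTranspose, hd, tracePow_eq_sum_eigenvalues q hρ]
    simp

end Qudits

end UnifiedConcurrence

/-! ### Marginals and the final assembly -/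

namespace UnifiedConcurrence

open scoped NNReal
open Matrix

lemma sum_marginal {Ω β : Type*} [Fintype Ω] [Fintype β] [DecidableEq β] (P : Ω → ℝ≥0)
    (Y : Ω → β) : ∑ y, ∑ a, (if Y a = y then P a else 0) = ∑ a, P a := by
  rw [Finset.sum_comm]
  simp

lemma marginal_marginal {Ω β γ : Type*} [Fintype Ω] [Fintype β] [DecidableEq β] [DecidableEq γ]
    (P : Ω → ℝ≥0) (Y : Ω → β) (f : β → γ) (c : γ) :
    ∑ y, (if f y = c then ∑ a, (if Y a = y then P a else 0) else 0) =
      ∑ a, if f (Y a) = c then P a else 0 := by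
  have h : ∀ y, (if f y = c then ∑ a, (if Y a = y then P a else 0) else 0) =
      ∑ a, if f y = c then (if Y a = y then P a else 0) else 0 := by
    intro y
    split_ifs <;> simp
  simp only [h]
  rw [Finset.sum_comm]
  refine Finset.sum_congr rfl fun a _ => ?_
  rw [Finset.sum_eq_single (Y a)]
  · simp
  · intro y _ hy
    simp [hy.symm]
  · simp

/-- `one_sub_norm_le_sum_marginals` including the trivial exponent `q = 1`. -/
lemma one_sub_norm_le_sum_marginals_of_one_le {ι β : Type*} [Fintype ι] [Fintype β]
    {α : ι → Type*} [∀ i, Fintype (α i)] [∀ i, DecidableEq (α i)]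
    (f : ∀ i, β → α i) (hf : ∀ y y', (∀ i, f i y = f i y') → y = y')
    (r : β → ℝ≥0) (hr : ∑ y, r y = 1) (q : ℝ) (hq : 1 ≤ q) :
    1 - ((∑ y, r y ^ q) ^ (1 / q) : ℝ≥0) ≤
      ∑ i, (1 - (((∑ c, (∑ y, if f i y = c then r y else 0) ^ q) ^ (1 / q) : ℝ≥0) : ℝ)) := by
  -- At `q = 1` the conjugate exponent is not finite, but all norms equal one and both sides vanish.
  rcases hq.eq_or_lt with rfl | hq
  · simp only [NNReal.rpow_one, div_one, sum_marginal, hr]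
    simp
  · exact one_sub_norm_le_sum_marginals f hf r hr q hq

lemma sum_rpow_le_one {α : Type*} [Fintype α] (μ : α → ℝ≥0) (hμ : ∑ c, μ c = 1) (q : ℝ)
    (hq : 1 ≤ q) : ∑ c, μ c ^ q ≤ 1 := by
  rw [← hμ]
  refine Finset.sum_le_sum fun c _ => NNReal.rpow_le_self_of_le_one ?_ hq
  rw [← hμ]
  exact Finset.single_le_sum (fun _ _ => zero_le) (Finset.mem_univ c)

/-- Subadditivity of the power deficit `1 - (tr ρ^q)^s` over a family of parties exhausting `S`. -/
theorem one_sub_tracePow_rpow_le_sum {ι κ : Type*} [Fintype ι] [DecidableEq ι] [Fintype κ]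
    {d : ι → ℕ} (ψ : QuditSpace d) (hψ : ‖ψ‖ = 1) (q s : ℝ) (hq : 1 ≤ q) (hqs : 1 ≤ q * s)
    (S : Finset ι) (p : κ → ι) (hpS : ∀ i, p i ∈ S) (hSp : ∀ k ∈ S, ∃ i, p i = k) :
    1 - tracePow q (reducedDensity (regroup S ψ)) ^ s ≤
      ∑ i, (1 - tracePow q (reducedDensity (regroup {p i} ψ)) ^ s) := by
  have hq0 : 0 < q := by linarith
  have hs0 : 0 < s := by
    by_contra h
    nlinarith
  choose V hV hVd using exists_local_diagonalisation ψ q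
  let P : ((k : ι) → Fin (d k)) → ℝ≥0 := fun a =>
    ⟨Complex.normSq (applyLocal V ψ a), Complex.normSq_nonneg _⟩
  have hP : ∑ a, P a = 1 := by
    apply NNReal.coe_injective
    rw [NNReal.coe_sum]
    refine (sum_normSq_applyLocal V hV ψ).trans ?_
    simp [hψ]
  let μ : (T : Finset ι) → ((k : {k // k ∈ T}) → Fin (d k)) → ℝ≥0 := fun T x =>
    ∑ a, if (fun k : {k // k ∈ T} => a k) = x then P a else 0
  have hμ : ∀ T, ∑ x, μ T x = 1 := fun T => (sum_marginal P _).trans hP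
  have hdiag : ∀ T x, (μ T x : ℝ) =
      (reducedDensity (regroup T (applyLocal V ψ)) x x).re := by
    intro T x
    rw [reducedDensity_diag, NNReal.coe_sum]
    refine Finset.sum_congr rfl fun a _ => ?_
    split_ifs <;> rfl
  have hsingle : ∀ k, ((∑ x, μ {k} x ^ q : ℝ≥0) : ℝ) =
      tracePow q (reducedDensity (regroup {k} ψ)) := by
    intro k
    rw [← hVd k V rfl, ← reducedDensity_applyLocal V hV]
    push_cast
    simp only [hdiag]
  have hjoint : ((∑ x, μ S x ^ q : ℝ≥0) : ℝ) ≤ tracePow q (reducedDensity (regroup S ψ)) := by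
    refine le_trans (le_of_eq ?_) (sum_diag_rpow_le_tracePow q hq (posSemidef_reducedDensity _)
      (tensorPi_mem_unitaryGroup fun k : {k // k ∈ S} => hV k))
    rw [← reducedDensity_applyLocal V hV]
    push_cast
    simp only [hdiag]
  let f : ∀ i, ((k : {k // k ∈ S}) → Fin (d k)) →
      ((k : {k // k ∈ ({p i} : Finset ι)}) → Fin (d k)) := fun i y k =>
    y ⟨k, by rw [Finset.mem_singleton.1 k.2]; exact hpS i⟩
  have hf : ∀ y y', (∀ i, f i y = f i y') → y = y' := by
    intro y y' h
    funext ⟨k, hk⟩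
    obtain ⟨i, rfl⟩ := hSp k hk
    exact congrFun (h i) ⟨p i, Finset.mem_singleton_self _⟩
  have hmarg : ∀ i c, ∑ y, (if f i y = c then μ S y else 0) = μ {p i} c := fun i c =>
    marginal_marginal P _ (f i) c
  have hmain := one_sub_norm_le_sum_marginals_of_one_le f hf (μ S) (hμ S) q hq
  simp only [hmarg] at hmain
  have hpow := one_sub_rpow_le_sum Finset.univ _ _ (q * s) hqs (NNReal.coe_nonneg _)
    (fun _ => NNReal.coe_nonneg _)
    (fun i => by
      have := NNReal.rpow_le_one (sum_rpow_le_one _ (hμ {p i}) q hq)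
        (by positivity : (0 : ℝ) ≤ 1 / q)
      exact_mod_cast this) hmain
  -- The exponent `q * s` was chosen to turn the `q`-norm into the `s`-th power of the `q`-power
  -- sum.
  have hexp : ∀ t : ℝ≥0, (((t ^ (1 / q) : ℝ≥0) : ℝ)) ^ (q * s) = (t : ℝ) ^ s := by
    intro t
    rw [NNReal.coe_rpow, ← Real.rpow_mul (NNReal.coe_nonneg t)]
    congr 1
    field_simp
  simp only [hexp, hsingle] at hpow
  exact (sub_le_sub_left (Real.rpow_le_rpow (NNReal.coe_nonneg _) hjoint hs0.le) _).trans hpow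

end UnifiedConcurrence

/-- The parties `A_1, …, A_m` are `Sum.inl i` and `B_1, …, B_n` are `Sum.inr j`; `d k` is the
dimension of the qudit `k`. -/
theorem mainTheorem8 (m n : ℕ) (d : Fin m ⊕ Fin n → ℕ)
    (ψ : UnifiedConcurrence.QuditSpace d) (hψ : ‖ψ‖ = 1)
    (q s : ℝ) (hq : 1 ≤ q) (hqs : 1 ≤ q * s) :
    UnifiedConcurrence.bipartitionConcurrence q s (Finset.univ.image Sum.inl) ψ ≤
      ∑ i : Fin m, UnifiedConcurrence.bipartitionConcurrence q s {Sum.inl i} ψ := by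
  have hsign : UnifiedConcurrence.signFactor q s = 1 := if_pos ⟨hq, hqs⟩
  simp only [UnifiedConcurrence.bipartitionConcurrence, UnifiedConcurrence.concurrence, hsign,
    one_mul]
  exact UnifiedConcurrence.one_sub_tracePow_rpow_le_sum ψ hψ q s hq hqs _ Sum.inl
    (fun i => Finset.mem_image_of_mem _ (Finset.mem_univ i)) (fun k hk => by simpa using hk)
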